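/- Theorem 3.2. Let $G=(V,E)$ be a finite connected undirected graph without loops, with at least two vertices and with $(i,j),(j,i)\in E$ for every edge, let $N(i)=\{j\in V\mid (i,j)\in E\}$, and let $\Delta x>0$, $\beta>0$, $(v_i)_{i\in V}\in\mathbb R^V$ and a symmetric real matrix $(w_{ij})_{i,j\in V}$ be given. Write $(\cdot)_+=\max\{\cdot,0\}$, let $$\mathcal P_o(G)=\Big\{\rho\in\mathbb R^V\ \Big|\ \sum_{i\in V}\rho_i=1,\ \rho_i>0\text{ for all } i\in V\Big\},$$ $$\mathcal F(\rho)=\sum_{i} v_i\rho_i+\tfrac12\sum_{i,j} w_{ij}\rho_i\rho_j+\beta\sum_i\rho_i\log\rho_i,\qquad F_i(\rho)=\frac{\partial\mathcal F}{\partial\rho_i}(\rho),$$ and consider on $\mathcal P_o(G)$ the ordinary differential equation $$\frac{d\rho_i}{dt}=\frac{1}{\Delta x^2}\Big\{\sum_{j\in N(i)}\rho_j\,(F_j(\rho)-F_i(\rho))_+-\sum_{j\in N(i)}\rho_i\,(F_i(\rho)-F_j(\rho))_+\Big\},\qquad i\in V. \tag{a1}$$ For $\rho\in\mathcal P_o(G)$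 put $f_{ij}=\frac{\partial^2\mathcal F}{\partial\rho_i\partial\rho_j}(\rho)$, $h_{ij,kl}=\frac{f_{ik}+f_{jl}-f_{il}-f_{jk}}{\Delta x^2}$ and $$\lambda_{\mathcal F}(\rho)=\min_{\Phi\in D}\ \sum_{(i,j)\in E}\sum_{(k,l)\in E}h_{ij,kl}\Big(\frac{\Phi_i-\Phi_j}{\Delta x}\Big)_+\rho_i\Big(\frac{\Phi_k-\Phi_l}{\Delta x}\Big)_+\rho_k,$$ $$D=\Big\{\Phi\in\mathbb R^V\ \Big|\ \sum_{(i,j)\in E}\Big(\frac{\Phi_i-\Phi_j}{\Delta x}\Big)_+^2\rho_i=1\Big\}.$$ Let $\rho:[0,\infty)\to\mathcal P_o(G)$ be a solution of (a1) with $\rho(0)=\rho^0$ and $\lim_{t\to\infty}\rho(t)=\rho^\infty$, where $\rho^\infty\in\mathcal P_o(G)$ is an isolated equilibrium of (a1) (isolated among the equilibria of (a1) in $\mathcal P_o(G)$), and assume that $\lambda_{\mathcal F}(\rho^\infty)>0$. Then there is a constant $C>0$, depending only on $\rho^0$ and on the fixed data $G,\Delta x,\beta,v,w$, such that for all $t\ge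 0$ $$\mathcal F(\rho(t))-\mathcal F(\rho^\infty)\le e^{-Ct}\big(\mathcal F(\rho^0)-\mathcal F(\rho^\infty)\big).$$ Moreover, for every $\epsilon>0$ there is a time $T>0$, depending only on $\epsilon$, $\rho^0$ and the same fixed data, such that for all $t>T$ $$\mathcal F(\rho(t))-\mathcal F(\rho^\infty)\le e^{-2(\lambda_{\mathcal F}(\rho^\infty)-\epsilon)(t-T)}\big(\mathcal F(\rho(T))-\mathcal F(\rho^\infty)\big).$$ -/

import Mathlib

open Filter Topology

namespace DiscreteFP

noncomputable section

/-- The open probability simplex `𝒫ₒ(G)` on the vertex set `V`: strictly positive weights of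
total mass one. -/
def openSimplex (V : Type*) [Fintype V] : Set (V → ℝ) :=
  {ρ | ∑ i, ρ i = 1 ∧ ∀ i, 0 < ρ i}

/-- The partial derivative `∂f/∂ρ_i` at `ρ`. -/
def partialDeriv {V : Type*} [DecidableEq V] (i : V) (f : (V → ℝ) → ℝ) (ρ : V → ℝ) : ℝ :=
  lineDeriv ℝ f ρ (Pi.single i 1)

/-- The discrete free energy
`ℱ(ρ) = ∑ v_i ρ_i + (1/2) ∑ w_ij ρ_i ρ_j + β ∑ ρ_i log ρ_i`. -/
def freeEnergy {V : Type*} [Fintype V] (v : V → ℝ) (w : Matrix V V ℝ) (β : ℝ)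
    (ρ : V → ℝ) : ℝ :=
  ∑ i, v i * ρ i + (1 / 2) * ∑ i, ∑ j, w i j * ρ i * ρ j + β * ∑ i, ρ i * Real.log (ρ i)

/-- The right-hand side of the scheme at the vertex `i`, where `F_i = ∂ℱ/∂ρ_i`:
`Δx⁻² (∑_{j ∈ N(i)} ρ_j (F_j - F_i)₊ - ∑_{j ∈ N(i)} ρ_i (F_i - F_j)₊)`. -/
def schemeRHS {V : Type*} [Fintype V] [DecidableEq V] (G : SimpleGraph V) [DecidableRel G.Adj]
    (dx : ℝ) (F : (V → ℝ) → ℝ) (ρ : V → ℝ) : V → ℝ := fun i =>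
  (1 / dx ^ 2) *
    (∑ j ∈ G.neighborFinset i, ρ j * max (partialDeriv j F ρ - partialDeriv i F ρ) 0
      - ∑ j ∈ G.neighborFinset i, ρ i * max (partialDeriv i F ρ - partialDeriv j F ρ) 0)

/-- `ρ : [0, ∞) → 𝒫ₒ(G)` solves the scheme with initial value `ρ₀`. Only the values of `ρ` at
times `t ≥ 0` matter, and the derivative at time `0` is one-sided. -/
def IsSolution {V : Type*} [Fintype V] [DecidableEq V] (G : SimpleGraph V) [DecidableRel G.Adj]
    (dx : ℝ) (F : (V → ℝ) → ℝ) (ρ₀ : V → ℝ) (ρ : ℝ → V → ℝ) : Prop :=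
  ρ 0 = ρ₀ ∧
    ∀ t : ℝ, 0 ≤ t → ρ t ∈ openSimplex V ∧
      HasDerivWithinAt ρ (schemeRHS G dx F (ρ t)) (Set.Ici 0) t

/-- The equilibria of the scheme: points of `𝒫ₒ(G)` at which the right-hand side vanishes. -/
def equilibria {V : Type*} [Fintype V] [DecidableEq V] (G : SimpleGraph V) [DecidableRel G.Adj]
    (dx : ℝ) (F : (V → ℝ) → ℝ) : Set (V → ℝ) :=
  {ρ | ρ ∈ openSimplex V ∧ schemeRHS G dx F ρ = 0}

/-- `ρ` is an equilibrium, and no other point of some neighbourhood of `ρ` is one. -/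
def IsIsolatedEquilibrium {V : Type*} [Fintype V] [DecidableEq V] (G : SimpleGraph V)
    [DecidableRel G.Adj] (dx : ℝ) (F : (V → ℝ) → ℝ) (ρ : V → ℝ) : Prop :=
  ρ ∈ equilibria G dx F ∧ ∀ᶠ σ in 𝓝[≠] ρ, σ ∉ equilibria G dx F

/-- The second partial derivative `f_ij = ∂²F/∂ρ_i∂ρ_j` at `ρ`. -/
def hess {V : Type*} [DecidableEq V] (F : (V → ℝ) → ℝ) (ρ : V → ℝ) (i j : V) : ℝ :=
  partialDeriv i (partialDeriv j F) ρ

/-- `h_{ij,kl} = (f_ik + f_jl - f_il - f_jk) / Δx²`. -/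
def hCoeff {V : Type*} [DecidableEq V] (dx : ℝ) (F : (V → ℝ) → ℝ) (ρ : V → ℝ)
    (i j k l : V) : ℝ :=
  (hess F ρ i k + hess F ρ j l - hess F ρ i l - hess F ρ j k) / dx ^ 2

/-- The sum over pairs of ordered edges
`∑_{(i,j) ∈ E} ∑_{(k,l) ∈ E} h_{ij,kl} ((Φ_i - Φ_j)/Δx)₊ ρ_i ((Φ_k - Φ_l)/Δx)₊ ρ_k`. -/
def rateForm {V : Type*} [Fintype V] [DecidableEq V] (G : SimpleGraph V) [DecidableRel G.Adj]
    (dx : ℝ) (F : (V → ℝ) → ℝ) (ρ Φ : V → ℝ) : ℝ :=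
  ∑ i, ∑ j ∈ G.neighborFinset i, ∑ k, ∑ l ∈ G.neighborFinset k,
    hCoeff dx F ρ i j k l * max ((Φ i - Φ j) / dx) 0 * ρ i * max ((Φ k - Φ l) / dx) 0 * ρ k

/-- The set `D` of potentials with `∑_{(i,j) ∈ E} ((Φ_i - Φ_j)/Δx)₊² ρ_i = 1`. -/
def unitPotentials {V : Type*} [Fintype V] (G : SimpleGraph V) [DecidableRel G.Adj]
    (dx : ℝ) (ρ : V → ℝ) : Set (V → ℝ) :=
  {Φ | ∑ i, ∑ j ∈ G.neighborFinset i, max ((Φ i - Φ j) / dx) 0 ^ 2 * ρ i = 1}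

/-- The dissipation rate `λ_F(ρ)`, the minimum of `rateForm` over `D`. For a connected graph with
at least two vertices and `ρ ∈ 𝒫ₒ(G)`, the set `D` is non-empty and compact modulo additive
constants, so that the infimum is a minimum. -/
def dissipationRate {V : Type*} [Fintype V] [DecidableEq V] (G : SimpleGraph V)
    [DecidableRel G.Adj] (dx : ℝ) (F : (V → ℝ) → ℝ) (ρ : V → ℝ) : ℝ :=
  sInf (rateForm G dx F ρ '' unitPotentials G dx ρ)

end

end DiscreteFP

/-!
Along a solution put `y t = F (ρ t) - F ρinf` and let `d t` be the dissipation of `F` at time `t`.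
Then `y' = -d` and, differentiating once more, `d' ≤ -k(ρ) d` with a rate `k` that is continuous on
the open positive orthant and equals `2 λ_F(ρinf)` at `ρinf`: only the positive parts are not
smooth, and they enter `d` through their squares. Since `y` and `d` both tend to zero, integrating
`d' ≤ 2 (λ_F(ρinf) - ε) y'` from `t` to infinity gives `d ≥ 2 (λ_F(ρinf) - ε) y` for large times,
and hence the asymptotic decay rate. On the remaining compact time interval `d' ≤ K d`, so
Gronwall's inequality bounds `y` by a multiple of `d` from time zero on. The constants depend only
on the initial value because the scheme is locally Lipschitz, so that solutions are unique.
-/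

namespace DiscreteFP

open Set

section DifferentialInequalities

theorem le_exp_mul_of_deriv_le_mul {f f' : ℝ → ℝ} {a b c : ℝ}
    (hf : ∀ t, a ≤ t → HasDerivWithinAt f (f' t) (Ici a) t)
    (h : ∀ t ∈ Ico a b, f' t ≤ c * f t) (hab : a ≤ b) :
    f b ≤ Real.exp (c * (b - a)) * f a := by
  have hcont : ContinuousOn f (Icc a b) := fun t ht =>
    (hf t ht.1).continuousWithinAt.mono Icc_subset_Ici_self
  have gronwall := le_gronwallBound_of_liminf_deriv_right_le (K := c) (ε := 0) hcont
    (fun t ht r hr =>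
      ((hf t ht.1).mono (Ici_subset_Ici.2 ht.1)).liminf_right_slope_le hr)
    le_rfl (fun t ht => by simpa using h t ht) b (right_mem_Icc.2 hab)
  rwa [gronwallBound_ε0, mul_comm] at gronwall

theorem mul_le_of_deriv_le_neg_mul {y d d' : ℝ → ℝ} {c T : ℝ}
    (hy : ∀ t, T ≤ t → HasDerivWithinAt y (-d t) (Ici T) t)
    (hd : ∀ t, T ≤ t → HasDerivWithinAt d (d' t) (Ici T) t)
    (h : ∀ t, T ≤ t → d' t ≤ -c * d t)
    (hy0 : Tendsto y atTop (𝓝 0)) (hd0 : Tendsto d atTop (𝓝 0)) {t : ℝ} (ht : T ≤ t) :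
    c * y t ≤ d t := by
  have hder (s : ℝ) (hs : T ≤ s) :
      HasDerivWithinAt (fun s => d s - c * y s) (d' s - c * -d s) (Ici T) s :=
    (hd s hs).sub ((hy s hs).const_mul c)
  have hanti : AntitoneOn (fun s => d s - c * y s) (Ici T) :=
    antitoneOn_of_hasDerivWithinAt_nonpos (convex_Ici T)
      (fun s hs => (hder s hs).continuousWithinAt)
      (fun s hs => (hder s (interior_subset hs)).mono interior_subset)
      fun s hs => by linarith [h s (interior_subset hs)]
  have hlim : Tendsto (fun s => d s - c * y s) atTop (𝓝 0) := by
    simpa using hd0.sub (hy0.const_mul c)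
  refine sub_nonneg.1 (le_of_tendsto hlim ?_)
  filter_upwards [eventually_ge_atTop t] with s hs
  exact hanti ht (ht.trans hs) hs

theorem sub_le_mul_of_deriv_le_mul {y d d' : ℝ → ℝ} {a b K : ℝ}
    (hy : ∀ t, a ≤ t → HasDerivWithinAt y (-d t) (Ici a) t)
    (hd : ∀ t, a ≤ t → HasDerivWithinAt d (d' t) (Ici a) t)
    (h : ∀ t ∈ Ico a b, d' t ≤ K * d t) (hda : 0 ≤ d a) (hK : 0 ≤ K) (hab : a ≤ b) :
    y a - y b ≤ Real.exp (K * (b - a)) * d a * (b - a) := by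
  set M := Real.exp (K * (b - a)) * d a
  have hdM (s : ℝ) (hs : s ∈ Icc a b) : d s ≤ M := by
    have hgrow := le_exp_mul_of_deriv_le_mul hd
      (fun r hr => h r ⟨hr.1, hr.2.trans_le hs.2⟩) hs.1
    exact hgrow.trans <| mul_le_mul_of_nonneg_right
      (Real.exp_le_exp.2 (by gcongr; exact hs.2)) hda
  have hder (s : ℝ) (hs : s ∈ Icc a b) :
      HasDerivWithinAt (fun s => y s + M * s) (-d s + M * 1) (Icc a b) s :=
    ((hy s hs.1).mono Icc_subset_Ici_self).add ((hasDerivWithinAt_id s _).const_mul M)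
  have hmono : MonotoneOn (fun s => y s + M * s) (Icc a b) :=
    monotoneOn_of_hasDerivWithinAt_nonneg (convex_Icc a b)
      (fun s hs => (hder s hs).continuousWithinAt)
      (fun s hs => (hder s (interior_subset hs)).mono interior_subset)
      fun s hs => by linarith [hdM s (interior_subset hs)]
  have : y a + M * a ≤ y b + M * b := hmono (left_mem_Icc.2 hab) (right_mem_Icc.2 hab) hab
  linarith

theorem exists_pos_mul_le_of_deriv_le_mul {y d d' : ℝ → ℝ} {c K T : ℝ}
    (hy : ∀ t, 0 ≤ t → HasDerivWithinAt y (-d t) (Ici 0) t)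
    (hd : ∀ t, 0 ≤ t → HasDerivWithinAt d (d' t) (Ici 0) t)
    (h : ∀ t ∈ Ico 0 T, d' t ≤ K * d t) (hd0 : ∀ t, 0 ≤ t → 0 ≤ d t)
    (hK : 0 ≤ K) (hc : 0 < c) (hT : 0 ≤ T) (hcy : ∀ t, T ≤ t → c * y t ≤ d t) :
    ∃ C, 0 < C ∧ ∀ t, 0 ≤ t → C * y t ≤ d t := by
  set M := Real.exp (K * T)
  have hM : 1 ≤ M := Real.one_le_exp (mul_nonneg hK hT)
  have hyT (t : ℝ) (ht : T ≤ t) : y t ≤ c⁻¹ * d t := (le_inv_mul_iff₀ hc).2 (hcy t ht)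
  refine ⟨(M * (c⁻¹ + T))⁻¹, by positivity, fun t ht => ?_⟩
  rw [inv_mul_le_iff₀ (by positivity)]
  have hdt := hd0 t ht
  rcases le_total T t with hTt | htT
  · calc y t ≤ c⁻¹ * d t := hyT t hTt
      _ ≤ (1 * (c⁻¹ + T)) * d t := by gcongr; linarith
      _ ≤ (M * (c⁻¹ + T)) * d t := by gcongr
  · have hsub : Ici t ⊆ Ici (0 : ℝ) := Ici_subset_Ici.2 ht
    have hexp : Real.exp (K * (T - t)) ≤ M := by
      simp only [M]
      gcongr
      linarith
    have hyt : y t - y T ≤ Real.exp (K * (T - t)) * d t * (T - t) :=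
      sub_le_mul_of_deriv_le_mul (fun s hs => (hy s (ht.trans hs)).mono hsub)
        (fun s hs => (hd s (ht.trans hs)).mono hsub)
        (fun s hs => h s ⟨ht.trans hs.1, hs.2⟩) hdt hK htT
    have hdT : d T ≤ Real.exp (K * (T - t)) * d t :=
      le_exp_mul_of_deriv_le_mul (fun s hs => (hd s (ht.trans hs)).mono hsub)
        (fun s hs => h s ⟨ht.trans hs.1, hs.2⟩) htT
    calc y t ≤ c⁻¹ * d T + Real.exp (K * (T - t)) * d t * (T - t) := by linarith [hyT T le_rfl]
      _ ≤ c⁻¹ * (M * d t) + M * d t * T := by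
        gcongr
        · exact hdT.trans (by gcongr)
        · linarith
      _ = M * (c⁻¹ + T) * d t := by ring

end DifferentialInequalities

section PositivePart

theorem hasDerivAt_max_zero_sq (x : ℝ) :
    HasDerivAt (fun x : ℝ => max x 0 ^ 2) (2 * max x 0) x := by
  have taylor (y : ℝ) : ‖max y 0 ^ 2 - max x 0 ^ 2 - (y - x) • (2 * max x 0)‖ ≤ ‖y - x‖ ^ 2 := by
    rw [Real.norm_eq_abs, Real.norm_eq_abs, sq_abs, smul_eq_mul, abs_le]
    rcases le_total x 0 with hx | hx <;> rcases le_total y 0 with hy | hy <;>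
      simp only [hx, hy, max_eq_left, max_eq_right] <;> constructor <;> nlinarith
  exact hasDerivAt_iff_isLittleO.2 <| (Asymptotics.IsBigO.of_norm_le taylor).trans_isLittleO <|
    Asymptotics.isLittleO_pow_sub_sub x one_lt_two

theorem lipschitzWith_max_zero (ι : Type*) [Fintype ι] :
    LipschitzWith 1 fun (x : ι → ℝ) i => max (x i) 0 := fun x y => by
  rw [ENNReal.coe_one, one_mul]
  exact edist_pi_le_iff.2 fun i => by
    simpa using ((LipschitzWith.eval i).max_const 0) x y

end PositivePart

section Uniqueness

theorem eqOn_Ici_of_locallyLipschitzOn {E : Type*} [NormedAddCommGroup E] [NormedSpace ℝ E]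
    {X : E → E} {s : Set E} (hX : LocallyLipschitzOn s X) {f g : ℝ → E} {a : ℝ}
    (hf : ∀ t, a ≤ t → f t ∈ s ∧ HasDerivWithinAt f (X (f t)) (Ici a) t)
    (hg : ∀ t, a ≤ t → g t ∈ s ∧ HasDerivWithinAt g (X (g t)) (Ici a) t) (h : f a = g a) :
    EqOn f g (Ici a) := by
  intro t ht
  have hfc : ContinuousOn f (Icc a t) := fun r hr =>
    (hf r hr.1).2.continuousWithinAt.mono Icc_subset_Ici_self
  have hgc : ContinuousOn g (Icc a t) := fun r hr =>
    (hg r hr.1).2.continuousWithinAt.mono Icc_subset_Ici_self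
  set K := f '' Icc a t ∪ g '' Icc a t
  have hK : IsCompact K :=
    (isCompact_Icc.image_of_continuousOn hfc).union (isCompact_Icc.image_of_continuousOn hgc)
  have hKs : K ⊆ s := by
    rintro _ (⟨r, hr, rfl⟩ | ⟨r, hr, rfl⟩)
    exacts [(hf r hr.1).1, (hg r hr.1).1]
  obtain ⟨L, hL⟩ := (hX.mono hKs).exists_lipschitzOnWith_of_compact hK
  exact ODE_solution_unique_of_mem_Icc_right (v := fun _ => X) (s := fun _ => K)
    (fun _ _ => hL)
    hfc (fun r hr => (hf r hr.1).2.mono (Ici_subset_Ici.2 hr.1))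
    (fun r hr => .inl ⟨r, Ico_subset_Icc_self hr, rfl⟩)
    hgc (fun r hr => (hg r hr.1).2.mono (Ici_subset_Ici.2 hr.1))
    (fun r hr => .inr ⟨r, Ico_subset_Icc_self hr, rfl⟩) h (right_mem_Icc.2 ht)

end Uniqueness

noncomputable section PartialDerivatives

variable {V : Type*} [DecidableEq V]

/-- The vector `(∂F/∂ρ_i)_i` of chemical potentials of the energy `F` at `ρ`. -/
def grad (F : (V → ℝ) → ℝ) (ρ : V → ℝ) : V → ℝ :=
  fun i => partialDeriv i F ρ

theorem partialDeriv_eq_fderiv [Finite V] {f : (V → ℝ) → ℝ} {ρ : V → ℝ}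
    (hf : DifferentiableAt ℝ f ρ) (i : V) :
    partialDeriv i f ρ = fderiv ℝ f ρ (Pi.single i 1) :=
  have := Fintype.ofFinite V
  hf.lineDeriv_eq_fderiv

variable [Fintype V]

theorem fderiv_apply_eq_sum_partialDeriv {f : (V → ℝ) → ℝ} {ρ : V → ℝ}
    (hf : DifferentiableAt ℝ f ρ) (x : V → ℝ) :
    fderiv ℝ f ρ x = ∑ i, partialDeriv i f ρ * x i := by
  conv_lhs => rw [pi_eq_sum_univ' x, map_sum]
  refine Finset.sum_congr rfl fun i _ => ?_
  rw [map_smul, smul_eq_mul, mul_comm, partialDeriv_eq_fderiv hf]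

theorem hasDerivWithinAt_comp_partialDeriv {f : (V → ℝ) → ℝ} {γ : ℝ → V → ℝ} {γ' : V → ℝ}
    {s : Set ℝ} {t : ℝ} (hf : DifferentiableAt ℝ f (γ t)) (hγ : HasDerivWithinAt γ γ' s t) :
    HasDerivWithinAt (fun t => f (γ t)) (∑ i, partialDeriv i f (γ t) * γ' i) s t :=
  fderiv_apply_eq_sum_partialDeriv hf γ' ▸ hf.hasFDerivAt.comp_hasDerivWithinAt t hγ

theorem contDiffOn_partialDeriv {f : (V → ℝ) → ℝ} {s : Set (V → ℝ)} {m n : WithTop ℕ∞}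
    (hf : ContDiffOn ℝ n f s) (hs : IsOpen s) (hmn : m + 1 ≤ n) (i : V) :
    ContDiffOn ℝ m (partialDeriv i f) s :=
  ((hf.fderiv_of_isOpen hs hmn).clm_apply contDiffOn_const).congr fun ρ hρ =>
    partialDeriv_eq_fderiv
      ((hf.differentiableOn (by rintro rfl; simp at hmn)).differentiableAt (hs.mem_nhds hρ)) i

end PartialDerivatives

section PositiveOrthant

/-- The open positive orthant `{ρ | ρ_i > 0 for all i}`, the natural open domain of the energy. -/
def posOrthant (V : Type*) : Set (V → ℝ) := {ρ | ∀ i, 0 < ρ i}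

variable {V : Type*}

theorem isOpen_posOrthant [Finite V] : IsOpen (posOrthant V) := by
  simpa only [posOrthant, ofPred_forall] using
    isOpen_iInter_of_finite fun i => isOpen_lt continuous_const (continuous_apply i)

theorem tendsto_comp_of_mem_posOrthant [Finite V] {α X : Type*} [TopologicalSpace X]
    {f : (V → ℝ) → X} {l : Filter α} {u : α → V → ℝ} {ρ : V → ℝ}
    (hf : ContinuousOn f (posOrthant V)) (hρ : ρ ∈ posOrthant V) (hu : Tendsto u l (𝓝 ρ)) :
    Tendsto (fun a => f (u a)) l (𝓝 (f ρ)) :=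
  (hf.continuousAt (isOpen_posOrthant.mem_nhds hρ)).tendsto.comp hu

variable [Fintype V]

theorem openSimplex_subset_posOrthant : openSimplex V ⊆ posOrthant V := fun _ hρ => hρ.2

theorem contDiffOn_freeEnergy (v : V → ℝ) (w : Matrix V V ℝ) (β : ℝ) {n : WithTop ℕ∞} :
    ContDiffOn ℝ n (freeEnergy v w β) (posOrthant V) := by
  have happly (i : V) : ContDiff ℝ n fun ρ : V → ℝ => ρ i := contDiff_apply ℝ ℝ i
  have hlog (i : V) : ContDiffOn ℝ n (fun ρ : V → ℝ => Real.log (ρ i)) (posOrthant V) :=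
    (happly i).contDiffOn.log fun ρ hρ => (hρ i).ne'
  unfold freeEnergy
  fun_prop

end PositiveOrthant

noncomputable section EdgeSums

variable {V : Type*}

/-- The upwind discrete gradient `((Φ_i - Φ_j)/Δx)₊` of a potential along the edge `(i, j)`. -/
def posGrad (dx : ℝ) (Φ : V → ℝ) (i j : V) : ℝ := max ((Φ i - Φ j) / dx) 0

theorem posGrad_nonneg (dx : ℝ) (Φ : V → ℝ) (i j : V) : 0 ≤ posGrad dx Φ i j := le_max_right _ _

theorem posGrad_smul (dx : ℝ) (Φ : V → ℝ) {c : ℝ} (hc : 0 ≤ c) (i j : V) :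
    posGrad dx (c • Φ) i j = c * posGrad dx Φ i j := by
  simp only [posGrad, mul_max_of_nonneg _ _ hc, mul_zero, Pi.smul_apply, smul_eq_mul, ← mul_sub,
    mul_div_assoc]

theorem sub_div_mul_posGrad (dx : ℝ) (Φ : V → ℝ) (i j : V) :
    (Φ i - Φ j) / dx * posGrad dx Φ i j = posGrad dx Φ i j ^ 2 := by
  rw [posGrad]
  rcases le_total ((Φ i - Φ j) / dx) 0 with h | h
  · simp [max_eq_right h]
  · rw [max_eq_left h, sq]

variable [Fintype V]

/-- The weighted energy `∑_{(i,j) ∈ E} ((Φ_i - Φ_j)/Δx)₊² ρ_i` of the potential `Φ`. At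
`Φ = grad F ρ` it is the rate at which the scheme dissipates `F`. -/
def dissipation (G : SimpleGraph V) [DecidableRel G.Adj] (dx : ℝ) (ρ Φ : V → ℝ) : ℝ :=
  ∑ i, ∑ j ∈ G.neighborFinset i, posGrad dx Φ i j ^ 2 * ρ i

/-- The net rate at which mass arrives at the vertex `i` when the density `ρ` is transported
down the potential `Φ`. The scheme is the case `Φ = grad F ρ`. -/
def upwindFlow (G : SimpleGraph V) [DecidableRel G.Adj] (dx : ℝ) (ρ Φ : V → ℝ) (i : V) : ℝ :=
  (∑ j ∈ G.neighborFinset i, posGrad dx Φ j i * ρ j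
    - ∑ j ∈ G.neighborFinset i, posGrad dx Φ i j * ρ i) / dx

variable (G : SimpleGraph V) [DecidableRel G.Adj] (dx : ℝ)

theorem sum_neighborFinset_comm {M : Type*} [AddCommMonoid M] (g : V → V → M) :
    ∑ i, ∑ j ∈ G.neighborFinset i, g i j = ∑ i, ∑ j ∈ G.neighborFinset i, g j i :=
  Finset.sum_comm' (by simp [G.adj_comm])

theorem schemeRHS_eq_upwindFlow [DecidableEq V] {dx : ℝ} (hdx : 0 < dx) (F : (V → ℝ) → ℝ)
    (ρ : V → ℝ) : schemeRHS G dx F ρ = upwindFlow G dx ρ (grad F ρ) := by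
  have hpos (i j : V) : max (partialDeriv i F ρ - partialDeriv j F ρ) 0
      = dx * posGrad dx (grad F ρ) i j := by
    rw [posGrad, mul_max_of_nonneg _ _ hdx.le, mul_zero, mul_div_cancel₀ _ hdx.ne', grad, grad]
  ext i
  simp only [schemeRHS, upwindFlow, hpos, ← Finset.sum_sub_distrib, Finset.mul_sum, Finset.sum_div]
  refine Finset.sum_congr rfl fun j _ => ?_
  field_simp

theorem sum_mul_upwindFlow (ρ Φ g : V → ℝ) :
    ∑ i, g i * upwindFlow G dx ρ Φ i =
      -∑ i, ∑ j ∈ G.neighborFinset i, (g i - g j) / dx * (posGrad dx Φ i j * ρ i) := by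
  have hin : ∑ i, ∑ j ∈ G.neighborFinset i, g i / dx * (posGrad dx Φ j i * ρ j)
      = ∑ i, ∑ j ∈ G.neighborFinset i, g j / dx * (posGrad dx Φ i j * ρ i) :=
    sum_neighborFinset_comm G _
  simp only [sub_div, sub_mul, Finset.sum_sub_distrib, neg_sub, ← hin]
  simp only [upwindFlow, ← Finset.sum_sub_distrib, Finset.sum_div, Finset.mul_sum]
  refine Finset.sum_congr rfl fun i _ => Finset.sum_congr rfl fun j _ => ?_
  ring

theorem sum_potential_mul_upwindFlow (ρ Φ : V → ℝ) :
    ∑ i, Φ i * upwindFlow G dx ρ Φ i = -dissipation G dx ρ Φ := by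
  simp only [sum_mul_upwindFlow, dissipation, ← mul_assoc, sub_div_mul_posGrad]

theorem rateForm_eq_sum_hess [DecidableEq V] (F : (V → ℝ) → ℝ) (ρ Φ : V → ℝ) :
    rateForm G dx F ρ Φ =
      ∑ i, (∑ k, hess F ρ i k * upwindFlow G dx ρ Φ k) * upwindFlow G dx ρ Φ i := by
  rw [sum_mul_upwindFlow G dx ρ Φ fun i => ∑ k, hess F ρ i k * upwindFlow G dx ρ Φ k]
  simp only [sum_mul_upwindFlow, rateForm, ← Finset.sum_neg_distrib, ← Finset.sum_sub_distrib,
    Finset.sum_div, Finset.sum_mul]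
  refine Finset.sum_congr rfl fun i _ => Finset.sum_congr rfl fun j _ =>
    Finset.sum_congr rfl fun k _ => Finset.sum_congr rfl fun l _ => ?_
  rw [hCoeff, posGrad, posGrad]
  ring

theorem hasDerivWithinAt_dissipation {ρ Φ : ℝ → V → ℝ} {ρ' Φ' : V → ℝ} {s : Set ℝ} {t : ℝ}
    (hρ : HasDerivWithinAt ρ ρ' s t) (hΦ : HasDerivWithinAt Φ Φ' s t) :
    HasDerivWithinAt (fun t => dissipation G dx (ρ t) (Φ t))
      (dissipation G dx ρ' (Φ t) - 2 * ∑ i, Φ' i * upwindFlow G dx (ρ t) (Φ t) i) s t := by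
  have hρi := hasDerivWithinAt_pi.1 hρ
  have hΦi := hasDerivWithinAt_pi.1 hΦ
  have hsq (i j : V) : HasDerivWithinAt (fun t => posGrad dx (Φ t) i j ^ 2)
      (2 * posGrad dx (Φ t) i j * ((Φ' i - Φ' j) / dx)) s t :=
    (hasDerivAt_max_zero_sq _).comp_hasDerivWithinAt t (((hΦi i).sub (hΦi j)).div_const dx)
  refine (HasDerivWithinAt.fun_sum fun i _ => HasDerivWithinAt.fun_sum fun j _ =>
    (hsq i j).mul (hρi i)).congr_deriv ?_
  rw [sum_mul_upwindFlow, mul_neg, sub_neg_eq_add, add_comm]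
  simp only [dissipation, Finset.mul_sum, ← Finset.sum_add_distrib]
  refine Finset.sum_congr rfl fun i _ => Finset.sum_congr rfl fun j _ => ?_
  ring

theorem dissipation_smul {c : ℝ} (hc : 0 ≤ c) (ρ Φ : V → ℝ) :
    dissipation G dx ρ (c • Φ) = c ^ 2 * dissipation G dx ρ Φ := by
  simp only [dissipation, posGrad_smul dx Φ hc, Finset.mul_sum, mul_pow, mul_assoc]

theorem dissipation_sub (ρ σ Φ : V → ℝ) :
    dissipation G dx (ρ - σ) Φ = dissipation G dx ρ Φ - dissipation G dx σ Φ := by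
  simp only [dissipation, Pi.sub_apply, mul_sub, Finset.sum_sub_distrib]

theorem dissipation_nonneg {ρ : V → ℝ} (hρ : 0 ≤ ρ) (Φ : V → ℝ) : 0 ≤ dissipation G dx ρ Φ :=
  Finset.sum_nonneg fun i _ => Finset.sum_nonneg fun _ _ => mul_nonneg (sq_nonneg _) (hρ i)

theorem abs_dissipation_le {ρ : V → ℝ} (hρ : ρ ∈ posOrthant V) (τ Φ : V → ℝ) :
    |dissipation G dx τ Φ| ≤ (∑ i, |τ i| / ρ i) * dissipation G dx ρ Φ := by
  simp only [dissipation, Finset.mul_sum]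
  refine (Finset.abs_sum_le_sum_abs _ _).trans <| Finset.sum_le_sum fun i _ =>
    (Finset.abs_sum_le_sum_abs _ _).trans <| Finset.sum_le_sum fun j _ => ?_
  have hi : |τ i| / ρ i ≤ ∑ i, |τ i| / ρ i :=
    Finset.single_le_sum (f := fun i => |τ i| / ρ i)
      (fun i _ => div_nonneg (abs_nonneg _) (hρ i).le) (Finset.mem_univ i)
  rw [abs_mul, abs_of_nonneg (sq_nonneg (posGrad dx Φ i j)), mul_left_comm]
  exact mul_le_mul_of_nonneg_left ((div_le_iff₀ (hρ i)).1 hi) (sq_nonneg _)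

theorem posGrad_sq_le {ρ : V → ℝ} (hρ : ρ ∈ posOrthant V) (Φ : V → ℝ) {i j : V}
    (hij : j ∈ G.neighborFinset i) :
    posGrad dx Φ i j ^ 2 ≤ (∑ i, 1 / ρ i) * dissipation G dx ρ Φ := by
  have hterm (i j : V) : 0 ≤ posGrad dx Φ i j ^ 2 * (1 : V → ℝ) i := by simp [sq_nonneg]
  calc posGrad dx Φ i j ^ 2 = posGrad dx Φ i j ^ 2 * (1 : V → ℝ) i := (mul_one _).symm
    _ ≤ ∑ j ∈ G.neighborFinset i, posGrad dx Φ i j ^ 2 * (1 : V → ℝ) i :=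
      Finset.single_le_sum (f := fun j => posGrad dx Φ i j ^ 2 * (1 : V → ℝ) i)
        (fun j _ => hterm i j) hij
    _ ≤ dissipation G dx 1 Φ :=
      Finset.single_le_sum
        (f := fun i => ∑ j ∈ G.neighborFinset i, posGrad dx Φ i j ^ 2 * (1 : V → ℝ) i)
        (fun i _ => Finset.sum_nonneg fun j _ => hterm i j) (Finset.mem_univ i)
    _ ≤ (∑ i, 1 / ρ i) * dissipation G dx ρ Φ := by
      simpa using (le_abs_self _).trans (abs_dissipation_le G dx hρ 1 Φ)

end EdgeSums

noncomputable section EdgeForms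

variable {V : Type*} [Fintype V] (G : SimpleGraph V) [DecidableRel G.Adj] (dx : ℝ)

/-- The `ℓ¹` norm `∑_{(i,j) ∈ E} ∑_{(k,l) ∈ E} |c_{ij,kl}|` of coefficients on pairs of edges. -/
def edgeNorm (c : V → V → V → V → ℝ) : ℝ :=
  ∑ i, ∑ j ∈ G.neighborFinset i, ∑ k, ∑ l ∈ G.neighborFinset k, |c i j k l|

/-- The quadratic form with coefficients `c` in the positive gradients of `Φ`. -/
def edgeForm (c : V → V → V → V → ℝ) (Φ : V → ℝ) : ℝ :=
  ∑ i, ∑ j ∈ G.neighborFinset i, ∑ k, ∑ l ∈ G.neighborFinset k,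
    c i j k l * (posGrad dx Φ i j * posGrad dx Φ k l)

theorem edgeForm_sub (c d : V → V → V → V → ℝ) (Φ : V → ℝ) :
    edgeForm G dx (c - d) Φ = edgeForm G dx c Φ - edgeForm G dx d Φ := by
  simp only [edgeForm, Pi.sub_apply, sub_mul, Finset.sum_sub_distrib]

theorem edgeForm_smul (c : V → V → V → V → ℝ) {a : ℝ} (ha : 0 ≤ a) (Φ : V → ℝ) :
    edgeForm G dx c (a • Φ) = a ^ 2 * edgeForm G dx c Φ := by
  simp only [edgeForm, posGrad_smul dx Φ ha, Finset.mul_sum]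
  refine Finset.sum_congr rfl fun i _ => Finset.sum_congr rfl fun j _ =>
    Finset.sum_congr rfl fun k _ => Finset.sum_congr rfl fun l _ => ?_
  ring

theorem abs_edgeForm_le {ρ : V → ℝ} (hρ : ρ ∈ posOrthant V) (c : V → V → V → V → ℝ)
    (Φ : V → ℝ) :
    |edgeForm G dx c Φ| ≤ edgeNorm G c * ((∑ i, 1 / ρ i) * dissipation G dx ρ Φ) := by
  simp only [edgeForm, edgeNorm, Finset.sum_mul _ _ ((∑ i, 1 / ρ i) * dissipation G dx ρ Φ)]
  refine (Finset.abs_sum_le_sum_abs _ _).trans <| Finset.sum_le_sum fun i _ =>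
    (Finset.abs_sum_le_sum_abs _ _).trans <| Finset.sum_le_sum fun j hj =>
    (Finset.abs_sum_le_sum_abs _ _).trans <| Finset.sum_le_sum fun k _ =>
    (Finset.abs_sum_le_sum_abs _ _).trans <| Finset.sum_le_sum fun l hl => ?_
  have hij := posGrad_sq_le G dx hρ Φ hj
  have hkl := posGrad_sq_le G dx hρ Φ hl
  have hnonneg := mul_nonneg (posGrad_nonneg dx Φ i j) (posGrad_nonneg dx Φ k l)
  rw [abs_mul, abs_of_nonneg hnonneg]
  refine mul_le_mul_of_nonneg_left ?_ (abs_nonneg _)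
  linarith [two_mul_le_add_sq (posGrad dx Φ i j) (posGrad dx Φ k l)]

end EdgeForms

noncomputable section RateComparison

variable {V : Type*} [Fintype V] [DecidableEq V] (G : SimpleGraph V) [DecidableRel G.Adj]
  (dx : ℝ) (F : (V → ℝ) → ℝ)

/-- The coefficients `h_{ij,kl} ρ_i ρ_k` of `rateForm` as a form in the positive gradients. -/
def rateCoeff {V : Type*} [DecidableEq V] (dx : ℝ) (F : (V → ℝ) → ℝ) (ρ : V → ℝ)
    (i j k l : V) : ℝ :=
  hCoeff dx F ρ i j k l * ρ i * ρ k

theorem rateForm_eq_edgeForm (ρ Φ : V → ℝ) :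
    rateForm G dx F ρ Φ = edgeForm G dx (rateCoeff dx F ρ) Φ := by
  refine Finset.sum_congr rfl fun i _ => Finset.sum_congr rfl fun j _ =>
    Finset.sum_congr rfl fun k _ => Finset.sum_congr rfl fun l _ => ?_
  rw [rateCoeff, posGrad, posGrad]
  ring

theorem bddBelow_rateForm_image_unitPotentials {ρ : V → ℝ} (hρ : ρ ∈ posOrthant V) :
    BddBelow (rateForm G dx F ρ '' unitPotentials G dx ρ) := by
  refine ⟨-(edgeNorm G (rateCoeff dx F ρ) * ∑ i, 1 / ρ i), ?_⟩
  rintro _ ⟨Φ, hΦ, rfl⟩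
  have hunit : dissipation G dx ρ Φ = 1 := hΦ
  have hform := abs_edgeForm_le G dx hρ (rateCoeff dx F ρ) Φ
  rw [hunit, mul_one, ← rateForm_eq_edgeForm] at hform
  exact (abs_le.1 hform).1

theorem dissipationRate_mul_dissipation_le {ρ : V → ℝ} (hρ : ρ ∈ posOrthant V) (Φ : V → ℝ) :
    dissipationRate G dx F ρ * dissipation G dx ρ Φ ≤ rateForm G dx F ρ Φ := by
  rcases (dissipation_nonneg G dx (fun i => (hρ i).le) Φ).eq_or_lt' with hzero | hpos
  · have hform := abs_edgeForm_le G dx hρ (rateCoeff dx F ρ) Φ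
    rw [hzero, mul_zero, mul_zero, ← rateForm_eq_edgeForm] at hform
    rw [hzero, mul_zero, abs_nonpos_iff.1 hform]
  · set d := dissipation G dx ρ Φ with hd
    have ha : 0 ≤ (√d)⁻¹ := by positivity
    have hsq : (√d)⁻¹ ^ 2 = d⁻¹ := by rw [inv_pow, Real.sq_sqrt hpos.le]
    have hunit : (√d)⁻¹ • Φ ∈ unitPotentials G dx ρ := by
      change dissipation G dx ρ _ = 1
      rw [dissipation_smul G dx ha, hsq, ← hd, inv_mul_cancel₀ hpos.ne']
    have hinf : dissipationRate G dx F ρ ≤ d⁻¹ * rateForm G dx F ρ Φ := by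
      rw [rateForm_eq_edgeForm, ← hsq, ← edgeForm_smul G dx _ ha, ← rateForm_eq_edgeForm]
      exact csInf_le (bddBelow_rateForm_image_unitPotentials G dx F hρ) (mem_image_of_mem _ hunit)
    rwa [mul_comm, ← le_inv_mul_iff₀ hpos]

/-- A lower bound for the exponential rate at which the dissipation decreases at `ρ`, obtained by
comparing the quadratic form at `ρ` with the one at `ρ'`. -/
def decayRate (ρ' ρ : V → ℝ) : ℝ :=
  2 * (dissipationRate G dx F ρ' - |dissipationRate G dx F ρ'| * ∑ i, |ρ i - ρ' i| / ρ i
      - edgeNorm G (rateCoeff dx F ρ - rateCoeff dx F ρ') * ∑ i, 1 / ρ i)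
    - ∑ i, |schemeRHS G dx F ρ i| / ρ i

theorem decayRate_self {ρ : V → ℝ} (hρ : schemeRHS G dx F ρ = 0) :
    decayRate G dx F ρ ρ = 2 * dissipationRate G dx F ρ := by
  simp [decayRate, edgeNorm, hρ]

theorem dissipation_sub_two_mul_rateForm_le {ρ ρ' : V → ℝ} (hρ : ρ ∈ posOrthant V)
    (hρ' : ρ' ∈ posOrthant V) (Φ : V → ℝ) :
    dissipation G dx (schemeRHS G dx F ρ) Φ - 2 * rateForm G dx F ρ Φ
      ≤ -decayRate G dx F ρ' ρ * dissipation G dx ρ Φ := by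
  set lam := dissipationRate G dx F ρ'
  have hlam : lam * dissipation G dx ρ' Φ ≤ rateForm G dx F ρ' Φ :=
    dissipationRate_mul_dissipation_le G dx F hρ' Φ
  have hweight : lam * (dissipation G dx ρ Φ - dissipation G dx ρ' Φ)
      ≤ |lam| * ((∑ i, |ρ i - ρ' i| / ρ i) * dissipation G dx ρ Φ) := by
    rw [← dissipation_sub]
    refine (le_abs_self _).trans ?_
    rw [abs_mul]
    exact mul_le_mul_of_nonneg_left (abs_dissipation_le G dx hρ (ρ - ρ') Φ) (abs_nonneg lam)
  have hform : rateForm G dx F ρ' Φ - rateForm G dx F ρ Φ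
      ≤ edgeNorm G (rateCoeff dx F ρ - rateCoeff dx F ρ')
        * ((∑ i, 1 / ρ i) * dissipation G dx ρ Φ) := by
    rw [rateForm_eq_edgeForm, rateForm_eq_edgeForm, ← neg_sub, ← edgeForm_sub]
    exact (neg_le_abs _).trans (abs_edgeForm_le G dx hρ _ Φ)
  have hflow := (le_abs_self _).trans (abs_dissipation_le G dx hρ (schemeRHS G dx F ρ) Φ)
  rw [decayRate]
  linarith

end RateComparison

section Regularity

variable {V : Type*} [Fintype V] [DecidableEq V] {F : (V → ℝ) → ℝ}

theorem contDiffOn_grad (hF : ContDiffOn ℝ 2 F (posOrthant V)) :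
    ContDiffOn ℝ 1 (grad F) (posOrthant V) :=
  contDiffOn_pi.2 (contDiffOn_partialDeriv hF isOpen_posOrthant one_add_one_eq_two.le)

theorem continuousOn_hess (hF : ContDiffOn ℝ 2 F (posOrthant V)) (i j : V) :
    ContinuousOn (fun ρ => hess F ρ i j) (posOrthant V) :=
  (contDiffOn_partialDeriv (m := 0) (contDiffOn_pi.1 (contDiffOn_grad hF) j) isOpen_posOrthant
    (zero_add 1).le i).continuousOn

variable (G : SimpleGraph V) [DecidableRel G.Adj] (dx : ℝ)

theorem locallyLipschitzOn_schemeRHS (hF : ContDiffOn ℝ 2 F (posOrthant V)) :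
    LocallyLipschitzOn (posOrthant V) (schemeRHS G dx F) := by
  -- For `ρ > 0` the scheme is a linear combination of positive parts of `ρ_i (F_i - F_j)`.
  let flux : (V → ℝ) → V × V → ℝ := fun ρ e => ρ e.1 * (grad F ρ e.1 - grad F ρ e.2)
  let divergence : (V × V → ℝ) →L[ℝ] V → ℝ := .pi fun i =>
    (1 / dx ^ 2) • ∑ j ∈ G.neighborFinset i, (.proj (j, i) - .proj (i, j))
  have hscheme {ρ : V → ℝ} (hρ : ρ ∈ posOrthant V) :
      schemeRHS G dx F ρ = divergence fun e => max (flux ρ e) 0 := by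
    ext i
    simp [schemeRHS, divergence, flux, grad, mul_max_of_nonneg _ _ (hρ _).le]
  have hgrad (i : V) : ContDiffOn ℝ 1 (fun ρ => grad F ρ i) (posOrthant V) :=
    contDiffOn_pi.1 (contDiffOn_grad hF) i
  have hflux : ContDiffOn ℝ 1 flux (posOrthant V) := contDiffOn_pi.2 fun e =>
    (contDiff_apply ℝ ℝ e.1).contDiffOn.mul ((hgrad e.1).sub (hgrad e.2))
  intro ρ hρ
  obtain ⟨K, t, ht, hK⟩ :=
    (hflux.contDiffAt (isOpen_posOrthant.mem_nhds hρ)).exists_lipschitzOnWith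
  have hcomp := (divergence.lipschitz.comp (lipschitzWith_max_zero (V × V))).comp_lipschitzOnWith hK
  refine ⟨‖divergence‖₊ * 1 * K, t ∩ posOrthant V, Filter.inter_mem (mem_nhdsWithin_of_mem_nhds ht)
    self_mem_nhdsWithin, fun σ hσ τ hτ => ?_⟩
  rw [hscheme hσ.2, hscheme hτ.2]
  exact hcomp hσ.1 hτ.1

theorem continuousOn_dissipation_grad (hF : ContDiffOn ℝ 2 F (posOrthant V)) :
    ContinuousOn (fun ρ => dissipation G dx ρ (grad F ρ)) (posOrthant V) := by
  have hgrad (i : V) : ContinuousOn (fun ρ => grad F ρ i) (posOrthant V) :=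
    continuousOn_pi.1 (contDiffOn_grad hF).continuousOn i
  unfold dissipation posGrad
  fun_prop

theorem continuousOn_decayRate (hF : ContDiffOn ℝ 2 F (posOrthant V)) (ρ' : V → ℝ) :
    ContinuousOn (decayRate G dx F ρ') (posOrthant V) := by
  have hhess := continuousOn_hess hF
  have hRHS (i : V) : ContinuousOn (fun ρ => schemeRHS G dx F ρ i) (posOrthant V) :=
    continuousOn_pi.1 (locallyLipschitzOn_schemeRHS G dx hF).continuousOn i
  have hinv (i : V) : ContinuousOn (fun ρ : V → ℝ => (ρ i)⁻¹) (posOrthant V) :=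
    (continuous_apply i).continuousOn.inv₀ fun ρ hρ => (hρ i).ne'
  unfold decayRate edgeNorm
  simp only [Pi.sub_apply, rateCoeff, hCoeff, div_eq_mul_inv]
  fun_prop

end Regularity

section Solutions

variable {V : Type*} [Fintype V] [DecidableEq V] {G : SimpleGraph V} [DecidableRel G.Adj]
  {dx : ℝ} {F : (V → ℝ) → ℝ} {ρ₀ ρinf : V → ℝ} {ρ σ : ℝ → V → ℝ}

theorem IsSolution.mem_posOrthant (hρ : IsSolution G dx F ρ₀ ρ) {t : ℝ} (ht : 0 ≤ t) :
    ρ t ∈ posOrthant V :=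
  openSimplex_subset_posOrthant (hρ.2 t ht).1

theorem IsSolution.eqOn (hF : ContDiffOn ℝ 2 F (posOrthant V)) (hρ : IsSolution G dx F ρ₀ ρ)
    (hσ : IsSolution G dx F ρ₀ σ) : EqOn ρ σ (Ici 0) :=
  eqOn_Ici_of_locallyLipschitzOn (locallyLipschitzOn_schemeRHS G dx hF)
    (fun t ht => ⟨hρ.mem_posOrthant ht, (hρ.2 t ht).2⟩)
    (fun t ht => ⟨hσ.mem_posOrthant ht, (hσ.2 t ht).2⟩) (hρ.1.trans hσ.1.symm)

theorem IsSolution.continuousOn_comp {f : (V → ℝ) → ℝ} (hf : ContinuousOn f (posOrthant V))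
    (hρ : IsSolution G dx F ρ₀ ρ) : ContinuousOn (fun t => f (ρ t)) (Ici 0) :=
  hf.comp (fun t ht => (hρ.2 t ht).2.continuousWithinAt) fun _ ht => hρ.mem_posOrthant ht

theorem IsSolution.hasDerivWithinAt_energy (hdx : 0 < dx) (hF : ContDiffOn ℝ 2 F (posOrthant V))
    (hρ : IsSolution G dx F ρ₀ ρ) {t : ℝ} (ht : 0 ≤ t) :
    HasDerivWithinAt (fun t => F (ρ t)) (-dissipation G dx (ρ t) (grad F (ρ t))) (Ici 0) t := by
  have hdiff : DifferentiableAt ℝ F (ρ t) :=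
    (hF.differentiableOn two_ne_zero).differentiableAt
      (isOpen_posOrthant.mem_nhds (hρ.mem_posOrthant ht))
  rw [← sum_potential_mul_upwindFlow, ← schemeRHS_eq_upwindFlow G hdx]
  exact hasDerivWithinAt_comp_partialDeriv hdiff (hρ.2 t ht).2

theorem IsSolution.hasDerivWithinAt_dissipation (hdx : 0 < dx)
    (hF : ContDiffOn ℝ 2 F (posOrthant V)) (hρ : IsSolution G dx F ρ₀ ρ) {t : ℝ} (ht : 0 ≤ t) :
    HasDerivWithinAt (fun t => dissipation G dx (ρ t) (grad F (ρ t)))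
      (dissipation G dx (schemeRHS G dx F (ρ t)) (grad F (ρ t))
        - 2 * rateForm G dx F (ρ t) (grad F (ρ t))) (Ici 0) t := by
  have hdiff (k : V) : DifferentiableAt ℝ (partialDeriv k F) (ρ t) :=
    ((contDiffOn_pi.1 (contDiffOn_grad hF) k).differentiableOn one_ne_zero).differentiableAt
      (isOpen_posOrthant.mem_nhds (hρ.mem_posOrthant ht))
  have hgrad : HasDerivWithinAt (fun t => grad F (ρ t))
      (fun k => ∑ i, hess F (ρ t) i k * schemeRHS G dx F (ρ t) i) (Ici 0) t :=
    hasDerivWithinAt_pi.2 fun k => hasDerivWithinAt_comp_partialDeriv (hdiff k) (hρ.2 t ht).2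
  refine (DiscreteFP.hasDerivWithinAt_dissipation G dx (hρ.2 t ht).2 hgrad).congr_deriv ?_
  rw [rateForm_eq_sum_hess, ← schemeRHS_eq_upwindFlow G hdx]
  simp only [Finset.sum_mul]
  rw [Finset.sum_comm]
  simp only [mul_right_comm]

theorem dissipation_grad_eq_zero (hdx : 0 < dx) {ρ : V → ℝ} (hρ : schemeRHS G dx F ρ = 0) :
    dissipation G dx ρ (grad F ρ) = 0 := by
  rw [← neg_eq_zero, ← sum_potential_mul_upwindFlow, ← schemeRHS_eq_upwindFlow G hdx, hρ]
  simp

theorem IsSolution.exists_mul_le_dissipation (hdx : 0 < dx)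
    (hF : ContDiffOn ℝ 2 F (posOrthant V)) (hρ : IsSolution G dx F ρ₀ ρ)
    (hinf : ρinf ∈ equilibria G dx F) (hlim : Tendsto ρ atTop (𝓝 ρinf)) {ε : ℝ} (hε : 0 < ε) :
    ∃ T, 0 < T ∧ ∀ t, T ≤ t → 2 * (dissipationRate G dx F ρinf - ε) * (F (ρ t) - F ρinf)
      ≤ dissipation G dx (ρ t) (grad F (ρ t)) := by
  have hinf_pos : ρinf ∈ posOrthant V := openSimplex_subset_posOrthant hinf.1
  have hrate : ∀ᶠ t in atTop,
      2 * (dissipationRate G dx F ρinf - ε) < decayRate G dx F ρinf (ρ t) := by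
    refine (tendsto_comp_of_mem_posOrthant (continuousOn_decayRate G dx hF ρinf) hinf_pos
      hlim).eventually_const_lt ?_
    rw [decayRate_self G dx F hinf.2]
    linarith
  obtain ⟨T, hT⟩ := eventually_atTop.1 (hrate.and (eventually_gt_atTop 0))
  have hT0 : 0 < T := (hT T le_rfl).2
  have hsub : Ici T ⊆ Ici (0 : ℝ) := Ici_subset_Ici.2 hT0.le
  refine ⟨T, hT0, fun t ht => mul_le_of_deriv_le_neg_mul (y := fun t => F (ρ t) - F ρinf)
    (fun s hs => ((hρ.hasDerivWithinAt_energy hdx hF (hsub hs)).sub_const _).mono hsub)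
    (fun s hs => (hρ.hasDerivWithinAt_dissipation hdx hF (hsub hs)).mono hsub)
    (fun s hs => ?_) ?_ ?_ ht⟩
  · refine (dissipation_sub_two_mul_rateForm_le G dx F (hρ.mem_posOrthant (hsub hs)) hinf_pos
      _).trans ?_
    gcongr
    · exact dissipation_nonneg G dx (fun i => (hρ.mem_posOrthant (hsub hs) i).le) _
    · exact (hT s hs).1.le
  · simpa using (tendsto_comp_of_mem_posOrthant hF.continuousOn hinf_pos hlim).sub_const (F ρinf)
  · simpa only [dissipation_grad_eq_zero hdx hinf.2] using
      tendsto_comp_of_mem_posOrthant (continuousOn_dissipation_grad G dx hF) hinf_pos hlim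

theorem IsSolution.exists_pos_mul_le_dissipation (hdx : 0 < dx)
    (hF : ContDiffOn ℝ 2 F (posOrthant V)) (hρ : IsSolution G dx F ρ₀ ρ)
    (hinf : ρinf ∈ equilibria G dx F) (hlim : Tendsto ρ atTop (𝓝 ρinf))
    (hpos : 0 < dissipationRate G dx F ρinf) :
    ∃ C, 0 < C ∧ ∀ t, 0 ≤ t →
      C * (F (ρ t) - F ρinf) ≤ dissipation G dx (ρ t) (grad F (ρ t)) := by
  have hinf_pos : ρinf ∈ posOrthant V := openSimplex_subset_posOrthant hinf.1
  have hnonneg (t : ℝ) (ht : 0 ≤ t) : 0 ≤ dissipation G dx (ρ t) (grad F (ρ t)) :=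
    dissipation_nonneg G dx (fun i => (hρ.mem_posOrthant ht i).le) _
  obtain ⟨T, hT, hlarge⟩ := hρ.exists_mul_le_dissipation hdx hF hinf hlim (half_pos hpos)
  obtain ⟨m, hm⟩ := (isCompact_Icc (a := 0) (b := T)).bddBelow_image
    ((hρ.continuousOn_comp (continuousOn_decayRate G dx hF ρinf)).mono Icc_subset_Ici_self)
  refine exists_pos_mul_le_of_deriv_le_mul (y := fun t => F (ρ t) - F ρinf) (K := max (-m) 0)
    (fun t ht => (hρ.hasDerivWithinAt_energy hdx hF ht).sub_const _)
    (fun t ht => hρ.hasDerivWithinAt_dissipation hdx hF ht)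
    (fun t ht => ?_) hnonneg (le_max_right _ _) (by linarith) hT.le hlarge
  refine (dissipation_sub_two_mul_rateForm_le G dx F (hρ.mem_posOrthant ht.1) hinf_pos _).trans ?_
  gcongr
  · exact hnonneg t ht.1
  · exact (neg_le_neg (hm (mem_image_of_mem _ (Ico_subset_Icc_self ht)))).trans (le_max_left _ _)

theorem IsSolution.energy_sub_le_exp_mul (hdx : 0 < dx) (hF : ContDiffOn ℝ 2 F (posOrthant V))
    (hρ : IsSolution G dx F ρ₀ ρ) {c T : ℝ} (hT : 0 ≤ T)
    (h : ∀ t, T ≤ t → c * (F (ρ t) - F ρinf) ≤ dissipation G dx (ρ t) (grad F (ρ t)))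
    {t : ℝ} (ht : T ≤ t) :
    F (ρ t) - F ρinf ≤ Real.exp (-c * (t - T)) * (F (ρ T) - F ρinf) :=
  le_exp_mul_of_deriv_le_mul (f := fun t => F (ρ t) - F ρinf)
    (fun _ hs => ((hρ.hasDerivWithinAt_energy hdx hF (hT.trans hs)).sub_const _).mono
      (Ici_subset_Ici.2 hT))
    (fun s hs => by linarith [h s hs.1]) ht

end Solutions

end DiscreteFP

theorem theorem3p2_general {V : Type*} [Fintype V] [DecidableEq V]
    (G : SimpleGraph V) [DecidableRel G.Adj] (dx : ℝ) (hdx : 0 < dx)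
    (F : (V → ℝ) → ℝ) (hF : ContDiffOn ℝ 2 F (DiscreteFP.posOrthant V))
    (ρ₀ ρinf : V → ℝ) (hinf : ρinf ∈ DiscreteFP.equilibria G dx F)
    (hpos : 0 < DiscreteFP.dissipationRate G dx F ρinf) :
    (∃ C : ℝ, 0 < C ∧
      ∀ ρ : ℝ → V → ℝ, DiscreteFP.IsSolution G dx F ρ₀ ρ → Tendsto ρ atTop (𝓝 ρinf) →
        ∀ t : ℝ, 0 ≤ t →
          F (ρ t) - F ρinf ≤ Real.exp (-C * t) * (F ρ₀ - F ρinf)) ∧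
    ∀ ε : ℝ, 0 < ε → ∃ T : ℝ, 0 < T ∧
      ∀ ρ : ℝ → V → ℝ, DiscreteFP.IsSolution G dx F ρ₀ ρ → Tendsto ρ atTop (𝓝 ρinf) →
        ∀ t : ℝ, T < t →
          F (ρ t) - F ρinf ≤
            Real.exp (-2 * (DiscreteFP.dissipationRate G dx F ρinf - ε) * (t - T)) *
              (F (ρ T) - F ρinf) := by
  by_cases hσ : ∃ σ, DiscreteFP.IsSolution G dx F ρ₀ σ ∧ Tendsto σ atTop (𝓝 ρinf)
  · obtain ⟨σ, hσ, hlim⟩ := hσ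
    refine ⟨?_, fun ε hε => ?_⟩
    · obtain ⟨C, hC, hCσ⟩ := hσ.exists_pos_mul_le_dissipation hdx hF hinf hlim hpos
      refine ⟨C, hC, fun ρ hρ _ t ht => ?_⟩
      rw [hρ.eqOn hF hσ ht]
      simpa only [sub_zero, hσ.1] using hσ.energy_sub_le_exp_mul hdx hF le_rfl hCσ ht
    · obtain ⟨T, hT, hTσ⟩ := hσ.exists_mul_le_dissipation hdx hF hinf hlim hε
      refine ⟨T, hT, fun ρ hρ _ t ht => ?_⟩
      rw [hρ.eqOn hF hσ (hT.trans ht).le, hρ.eqOn hF hσ hT.le, neg_mul]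
      exact hσ.energy_sub_le_exp_mul hdx hF hT.le hTσ ht.le
  · push Not at hσ
    exact ⟨⟨1, one_pos, fun ρ hρ hlim => absurd hlim (hσ ρ hρ)⟩,
      fun _ _ => ⟨1, one_pos, fun ρ hρ hlim => absurd hlim (hσ ρ hρ)⟩⟩

theorem theorem3p2 {V : Type*} [Fintype V] [DecidableEq V]
    (G : SimpleGraph V) [DecidableRel G.Adj] (hG : G.Connected)
    (dx : ℝ) (hdx : 0 < dx) (β : ℝ) (hβ : 0 < β)
    (v : V → ℝ) (w : Matrix V V ℝ) (hw : w.IsSymm)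
    (F : (V → ℝ) → ℝ) (hF : F = DiscreteFP.freeEnergy v w β)
    (ρ₀ ρinf : V → ℝ)
    (hinf : DiscreteFP.IsIsolatedEquilibrium G dx F ρinf)
    (hpos : 0 < DiscreteFP.dissipationRate G dx F ρinf) :
    (∃ C : ℝ, 0 < C ∧
      ∀ ρ : ℝ → V → ℝ, DiscreteFP.IsSolution G dx F ρ₀ ρ → Tendsto ρ atTop (𝓝 ρinf) →
        ∀ t : ℝ, 0 ≤ t →
          F (ρ t) - F ρinf ≤ Real.exp (-C * t) * (F ρ₀ - F ρinf)) ∧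
    ∀ ε : ℝ, 0 < ε → ∃ T : ℝ, 0 < T ∧
      ∀ ρ : ℝ → V → ℝ, DiscreteFP.IsSolution G dx F ρ₀ ρ → Tendsto ρ atTop (𝓝 ρinf) →
        ∀ t : ℝ, T < t →
          F (ρ t) - F ρinf ≤
            Real.exp (-2 * (DiscreteFP.dissipationRate G dx F ρinf - ε) * (t - T)) *
              (F (ρ T) - F ρinf) := by
  subst hF
  exact theorem3p2_general G dx hdx _ (DiscreteFP.contDiffOn_freeEnergy v w β) ρ₀ ρinf hinf.1 hpos
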